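/- For $n\ge 2$ let $VT_n$ be the virtual twin group: the group with generators $s_1,\dots,s_{n-1},\rho_1,\dots,\rho_{n-1}$ and defining relations $$s_i^2=1,\quad \rho_i^2=1,\quad s_is_j=s_js_i,\ \ \rho_i\rho_j=\rho_j\rho_i,\ \ \rho_is_j=s_j\rho_i\ \ (|i-j|\ge 2),$$ $$\rho_i\rho_{i+1}\rho_i=\rho_{i+1}\rho_i\rho_{i+1},\qquad \rho_i\rho_{i+1}s_i=s_{i+1}\rho_i\rho_{i+1}\quad(1\le i\le n-2).$$ Let $\tau_i=(i,i+1)\in S_n$, let $\lambda:S_n\to VT_n$ be the homomorphism with $\lambda(\tau_i)=\rho_i$, and let $\theta:VT_n\to S_n$ be the homomorphism with $\theta(s_i)=1$ and $\theta(\rho_i)=\tau_i$. A homomorphism is called abelian if its image is abelian, and homomorphisms $\psi_1,\psi_2:G\to H$ are called conjugate if there is $x\in H$ with $\psi_2(g)=x\psi_1(g)x^{-1}$ for all $g\in G$. Fix a non-inner automorphism $\nu$ of $S_6$ (such automorphisms exist, and may be chosen of order two). (a) Let $n,m$ be integers with $n\ge m$, $n\ge 5$ and $m\ge 2$, and let $\phi:S_n\to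 VT_m$ be a homomorphism. Then at least one of the following holds: 1. $\phi$ is abelian; 2. $n=m$ and $\phi$ is conjugate to $\lambda$; 3. $n=m=6$ and $\phi$ is conjugate to $\lambda\circ\nu$. (b) Let $n\ge 3$ and let $\phi:S_n\to VT_n$ be a homomorphism with $\theta\circ\phi=\mathrm{id}_{S_n}$. Then $\phi$ is conjugate to $\lambda$. -/

import Mathlib

open Equiv

/-! ### Virtual twin groups -/

/-- The generators `s₁, …, s_{n-1}, ρ₁, …, ρ_{n-1}` of the virtual twin group, indexed from `0`. -/
inductive VTGen (n : ℕ) : Type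
  | s (i : Fin (n - 1)) : VTGen n
  | rho (i : Fin (n - 1)) : VTGen n

/-- The letter `sᵢ` in the free group on the generators. -/
def sLetter {n : ℕ} (i : Fin (n - 1)) : FreeGroup (VTGen n) := FreeGroup.of (VTGen.s i)

/-- The letter `ρᵢ` in the free group on the generators. -/
def rhoLetter {n : ℕ} (i : Fin (n - 1)) : FreeGroup (VTGen n) := FreeGroup.of (VTGen.rho i)

/-- Indices at distance at least two. -/
def FarApart {k : ℕ} (i j : Fin k) : Prop := (i : ℕ) + 2 ≤ j ∨ (j : ℕ) + 2 ≤ i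

/-- The defining relators of the virtual twin group; the relation `u = v` is the relator
`u * v⁻¹`. -/
inductive VTRel (n : ℕ) : FreeGroup (VTGen n) → Prop
  | s_sq (i : Fin (n - 1)) : VTRel n (sLetter i * sLetter i)
  | s_comm (i j : Fin (n - 1)) (h : FarApart i j) :
      VTRel n ((sLetter i * sLetter j) * (sLetter j * sLetter i)⁻¹)
  | rho_sq (i : Fin (n - 1)) : VTRel n (rhoLetter i * rhoLetter i)
  | rho_comm (i j : Fin (n - 1)) (h : FarApart i j) :
      VTRel n ((rhoLetter i * rhoLetter j) * (rhoLetter j * rhoLetter i)⁻¹)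
  | rho_braid (i j : Fin (n - 1)) (h : (j : ℕ) = i + 1) :
      VTRel n ((rhoLetter i * rhoLetter j * rhoLetter i) *
        (rhoLetter j * rhoLetter i * rhoLetter j)⁻¹)
  | rho_s_comm (i j : Fin (n - 1)) (h : FarApart i j) :
      VTRel n ((rhoLetter i * sLetter j) * (sLetter j * rhoLetter i)⁻¹)
  | mixed (i j : Fin (n - 1)) (h : (j : ℕ) = i + 1) :
      VTRel n ((rhoLetter i * rhoLetter j * sLetter i) *
        (sLetter j * rhoLetter i * rhoLetter j)⁻¹)

/-- The virtual twin group `VT_n`. -/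
abbrev VT (n : ℕ) : Type := PresentedGroup {r : FreeGroup (VTGen n) | VTRel n r}

/-- The generator `ρᵢ` of `VT_n`. -/
def VT.rho {n : ℕ} (i : Fin (n - 1)) : VT n := PresentedGroup.of (VTGen.rho i)

/-- The generator `sᵢ` of `VT_n`. -/
def VT.s {n : ℕ} (i : Fin (n - 1)) : VT n := PresentedGroup.of (VTGen.s i)

/-! ### Symmetric groups: adjacent transpositions and the Coxeter presentation -/

/-- The transposition `τᵢ` of the adjacent points `i` and `i + 1`. -/
def adjSwap {n : ℕ} (i : Fin (n - 1)) : Perm (Fin n) :=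
  swap ⟨i, by omega⟩ ⟨(i : ℕ) + 1, by omega⟩

/-- A family `t` satisfies the Coxeter relations of the generators `τᵢ` of the symmetric
group. -/
structure SymRelations {G : Type*} [Group G] {k : ℕ} (t : Fin k → G) : Prop where
  sq : ∀ i, t i * t i = 1
  comm : ∀ i j : Fin k, (i : ℕ) + 2 ≤ j → t i * t j = t j * t i
  braid : ∀ i j : Fin k, (j : ℕ) = i + 1 → t i * t j * t i = t j * t i * t j

/-- The product `T_{j+d-1} ⋯ T_{j+1} T_j`. -/
def descProd {G : Type*} [Group G] (T : ℕ → G) (j : ℕ) : ℕ → G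
  | 0 => 1
  | d + 1 => T (j + d) * descProd T j d

section Presentation

variable {G : Type*} [Group G] {T : ℕ → G} {N : ℕ}

theorem descProd_comm_low (hc : ∀ i j, i + 2 ≤ j → j < N → T i * T j = T j * T i)
    {i j : ℕ} (hi : i + 2 ≤ j) (d : ℕ) (hd : j + d ≤ N) :
    descProd T j d * T i = T i * descProd T j d := by
  induction d with
  | zero => simp [descProd]
  | succ d ih =>
    rw [descProd, mul_assoc, ih (by omega), ← mul_assoc, ← mul_assoc,
      hc i (j + d) (by omega) (by omega)]

theorem descProd_comm_high (hc : ∀ i j, i + 2 ≤ j → j < N → T i * T j = T j * T i)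
    {i j : ℕ} (hiN : i < N) (d : ℕ) (hd : j + d + 1 ≤ i) :
    descProd T j d * T i = T i * descProd T j d := by
  induction d with
  | zero => simp [descProd]
  | succ d ih =>
    rw [descProd, mul_assoc, ih (by omega), ← mul_assoc, ← mul_assoc,
      hc (j + d) i (by omega) (by omega)]

theorem descProd_extend (T : ℕ → G) (j d : ℕ) :
    descProd T (j + 1) d * T j = descProd T j (d + 1) := by
  induction d with
  | zero => simp [descProd]
  | succ d ih =>
    rw [descProd, mul_assoc, ih, descProd.eq_2 T j (d + 1), show j + 1 + d = j + (d + 1) by omega]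

theorem descProd_shift (hc : ∀ i j, i + 2 ≤ j → j < N → T i * T j = T j * T i)
    (hb : ∀ i, i + 1 < N → T i * T (i + 1) * T i = T (i + 1) * T i * T (i + 1))
    {i j : ℕ} (hij : j ≤ i) (d : ℕ) (hd : j + d ≤ N) (hi : i + 1 < j + d) :
    descProd T j d * T (i + 1) = T i * descProd T j d := by
  induction d with
  | zero => omega
  | succ d ih =>
    rcases Nat.lt_or_ge (i + 1) (j + d) with h | h
    · rw [descProd, mul_assoc, ih (by omega) h, ← mul_assoc, ← mul_assoc,
        hc i (j + d) (by omega) (by omega)]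
    · obtain ⟨e, rfl⟩ : ∃ e, d = e + 1 := ⟨d - 1, by omega⟩
      obtain rfl : i = j + e := by omega
      have hh := descProd_comm_high (T := T) hc (i := j + e + 1) (j := j) (by omega) e (by omega)
      have hbr := hb (j + e) (by omega)
      simp only [descProd, ← add_assoc]
      calc T (j + e + 1) * (T (j + e) * descProd T j e) * T (j + e + 1)
          = T (j + e + 1) * T (j + e) * (descProd T j e * T (j + e + 1)) := by group
        _ = T (j + e + 1) * T (j + e) * T (j + e + 1) * descProd T j e := by rw [hh]; group
        _ = T (j + e) * (T (j + e + 1) * (T (j + e) * descProd T j e)) := by rw [← hbr]; group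

/-- The coset decomposition behind the Coxeter presentation of the symmetric group. -/
theorem closure_decomp (hs : ∀ i, i < N → T i * T i = 1)
    (hc : ∀ i j, i + 2 ≤ j → j < N → T i * T j = T j * T i)
    (hb : ∀ i, i + 1 < N → T i * T (i + 1) * T i = T (i + 1) * T i * T (i + 1))
    {k : ℕ} (hk : k < N) {x : G} (hx : x ∈ Submonoid.closure (T '' Set.Iio (k + 1))) :
    ∃ y ∈ Submonoid.closure (T '' Set.Iio k), ∃ j d, j + d = k + 1 ∧ x = y * descProd T j d := by
  induction hx using Submonoid.closure_induction_right with
  | one => exact ⟨1, one_mem _, k + 1, 0, rfl, by simp [descProd]⟩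
  | mul_right x hx z hz ih =>
    obtain ⟨i, hi, rfl⟩ := hz
    simp only [Set.mem_Iio] at hi
    obtain ⟨y, hy, j, d, hjd, rfl⟩ := ih
    have mem : ∀ l, l < k → y * T l ∈ Submonoid.closure (T '' Set.Iio k) := fun l hl =>
      mul_mem hy (Submonoid.subset_closure ⟨l, hl, rfl⟩)
    rcases Nat.lt_or_ge i j with h | h
    · rcases Nat.lt_or_ge (i + 1) j with h' | h'
      · refine ⟨y * T i, mem i (by omega), j, d, hjd, ?_⟩
        rw [mul_assoc, descProd_comm_low hc h' d (by omega), mul_assoc]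
      · obtain rfl : j = i + 1 := by omega
        exact ⟨y, hy, i, d + 1, by omega, by rw [mul_assoc, descProd_extend]⟩
    · rcases Nat.eq_or_lt_of_le h with h' | h'
      · subst h'
        obtain ⟨e, rfl⟩ : ∃ e, d = e + 1 := ⟨d - 1, by omega⟩
        refine ⟨y, hy, j + 1, e, by omega, ?_⟩
        rw [← descProd_extend, mul_assoc, mul_assoc, hs j (by omega), mul_one]
      · obtain ⟨l, rfl⟩ : ∃ l, i = l + 1 := ⟨i - 1, by omega⟩
        refine ⟨y * T l, mem l (by omega), j, d, hjd, ?_⟩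
        rw [mul_assoc, descProd_shift hc hb (by omega) d (by omega) (by omega), mul_assoc]

end Presentation

theorem adjSwap_relations (n : ℕ) : SymRelations (adjSwap (n := n)) where
  sq i := swap_mul_self _ _
  comm i j h := by
    refine (Perm.Disjoint.commute ?_).eq
    rw [Perm.disjoint_iff_disjoint_support]
    unfold adjSwap
    rw [Perm.support_swap (by simp [Fin.ext_iff]), Perm.support_swap (by simp [Fin.ext_iff])]
    simp [Fin.ext_iff]
    omega
  braid i j h := by
    unfold adjSwap
    obtain ⟨i, hi⟩ := i
    obtain ⟨j, hj⟩ := j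
    simp only at h
    subst h
    ext x
    simp only [Perm.mul_apply, swap_apply_def, Fin.ext_iff, apply_ite Fin.val]
    grind

/-- The pairs `(tᵢ, τᵢ)`, continued by `1`. -/
def pairSeq {G : Type*} [Group G] {n : ℕ} (t : Fin (n - 1) → G) (i : ℕ) : G × Perm (Fin n) :=
  if h : i < n - 1 then (t ⟨i, h⟩, adjSwap ⟨i, h⟩) else 1

section Lift

variable {G : Type*} [Group G] {n : ℕ} {t : Fin (n - 1) → G}

theorem pairSeq_sq (ht : SymRelations t) (i : ℕ) : pairSeq t i * pairSeq t i = 1 := by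
  unfold pairSeq
  split_ifs with h
  · exact Prod.ext (ht.sq _) ((adjSwap_relations n).sq _)
  · simp

theorem pairSeq_comm (ht : SymRelations t) (i j : ℕ) (hij : i + 2 ≤ j) :
    pairSeq t i * pairSeq t j = pairSeq t j * pairSeq t i := by
  unfold pairSeq
  split_ifs with h h'
  · exact Prod.ext (ht.comm _ _ hij) ((adjSwap_relations n).comm _ _ hij)
  all_goals simp

theorem pairSeq_braid (ht : SymRelations t) (i : ℕ) (hi : i + 1 < n - 1) :
    pairSeq t i * pairSeq t (i + 1) * pairSeq t i =
      pairSeq t (i + 1) * pairSeq t i * pairSeq t (i + 1) := by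
  unfold pairSeq
  rw [dif_pos hi, dif_pos (by omega : i < n - 1)]
  exact Prod.ext (ht.braid _ _ rfl) ((adjSwap_relations n).braid _ _ rfl)

theorem pairSeq_fixes (i : ℕ) (x : Fin n) (hx : i + 1 < x) : (pairSeq t i).2 x = x := by
  unfold pairSeq
  split_ifs with h
  · exact swap_apply_of_ne_of_ne (by simp [Fin.ext_iff]; omega) (by simp [Fin.ext_iff]; omega)
  · rfl

theorem descProd_pairSeq_apply (j d : ℕ) (h : j + d ≤ n - 1) (hn : 0 < n) :
    (descProd (pairSeq t) j d).2 ⟨j, by omega⟩ = ⟨j + d, by omega⟩ := by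
  induction d with
  | zero => rfl
  | succ d ih =>
    rw [descProd, Prod.snd_mul, Perm.mul_apply, ih (by omega)]
    unfold pairSeq
    rw [dif_pos (by omega : j + d < n - 1)]
    exact swap_apply_left _ _

theorem closure_fixes (k : ℕ) {y : G × Perm (Fin n)}
    (hy : y ∈ Submonoid.closure (pairSeq t '' Set.Iio k)) (x : Fin n) (hx : k < x) :
    y.2 x = x := by
  induction hy using Submonoid.closure_induction with
  | mem z hz =>
    obtain ⟨i, hi, rfl⟩ := hz
    simp only [Set.mem_Iio] at hi
    exact pairSeq_fixes i x (by omega)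
  | one => rfl
  | mul a b _ _ ha hb => rw [Prod.snd_mul, Perm.mul_apply, hb, ha]

theorem closure_fst_eq_one (ht : SymRelations t) (k : ℕ) (hk : k ≤ n - 1) {x : G × Perm (Fin n)}
    (hx : x ∈ Submonoid.closure (pairSeq t '' Set.Iio k)) (h1 : x.2 = 1) : x.1 = 1 := by
  induction k generalizing x with
  | zero =>
    have : pairSeq t '' Set.Iio 0 = ∅ := by ext; simp
    rw [this, Submonoid.closure_empty, Submonoid.mem_bot] at hx
    rw [hx]; rfl
  | succ k ih =>
    obtain ⟨y, hy, j, d, hjd, rfl⟩ := closure_decomp (N := n - 1)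
      (fun i _ => pairSeq_sq ht i) (fun i j h _ => pairSeq_comm ht i j h)
      (fun i h => pairSeq_braid ht i h) (by omega) hx
    have hn : 0 < n := by omega
    have hap := descProd_pairSeq_apply (t := t) j d (by omega) hn
    have hfix := closure_fixes k hy ⟨j + d, by omega⟩ (by simp; omega)
    have := congrArg (fun σ : Perm (Fin n) => σ ⟨j, by omega⟩) h1
    simp only [Prod.snd_mul, Perm.mul_apply, Perm.one_apply, hap, hfix, Fin.mk.injEq] at this
    obtain rfl : d = 0 := by omega
    simp only [descProd, mul_one] at h1 ⊢
    exact ih (by omega) hy h1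

theorem closure_adjSwap (n : ℕ) :
    Submonoid.closure (Set.range (adjSwap (n := n))) = ⊤ := by
  cases n with
  | zero => exact Subsingleton.elim _ _
  | succ n => exact Perm.mclosure_swap_castSucc_succ n

variable (t) in
/-- The submonoid of `G × S_n` generated by the pairs `(tᵢ, τᵢ)`. -/
def pairMonoid : Submonoid (G × Perm (Fin n)) :=
  Submonoid.closure (pairSeq t '' Set.Iio (n - 1))

theorem pair_mem (i : Fin (n - 1)) : (t i, adjSwap i) ∈ pairMonoid t :=
  Submonoid.subset_closure ⟨i, i.2, by simp [pairSeq]⟩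

theorem pairMonoid_snd_surjective (σ : Perm (Fin n)) : ∃ x ∈ pairMonoid t, x.2 = σ := by
  have h : σ ∈ Submonoid.closure (Set.range (adjSwap (n := n))) := by
    rw [closure_adjSwap]; trivial
  induction h using Submonoid.closure_induction with
  | mem z hz => obtain ⟨i, rfl⟩ := hz; exact ⟨_, pair_mem i, rfl⟩
  | one => exact ⟨1, one_mem _, rfl⟩
  | mul a b _ _ ha hb =>
    obtain ⟨x, hx, rfl⟩ := ha
    obtain ⟨y, hy, rfl⟩ := hb
    exact ⟨x * y, mul_mem hx hy, rfl⟩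

theorem pairMonoid_inv (ht : SymRelations t) {x : G × Perm (Fin n)} (hx : x ∈ pairMonoid t) :
    x⁻¹ ∈ pairMonoid t := by
  unfold pairMonoid at hx
  induction hx using Submonoid.closure_induction with
  | mem z hz =>
    obtain ⟨i, hi, rfl⟩ := hz
    rw [inv_eq_of_mul_eq_one_left (pairSeq_sq ht i)]
    exact Submonoid.subset_closure ⟨i, hi, rfl⟩
  | one => rw [inv_one]; exact one_mem _
  | mul a b _ _ ha hb => rw [mul_inv_rev]; exact mul_mem hb ha

theorem pairMonoid_functional (ht : SymRelations t) {x y : G × Perm (Fin n)}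
    (hx : x ∈ pairMonoid t) (hy : y ∈ pairMonoid t) (h : x.2 = y.2) : x.1 = y.1 := by
  have := closure_fst_eq_one ht (n - 1) le_rfl (mul_mem hx (pairMonoid_inv ht hy))
    (by simp [h])
  simpa [mul_inv_eq_one] using this

/-- The homomorphism out of the symmetric group that sends `τᵢ` to `tᵢ`, for a family `t` that
satisfies the Coxeter relations. -/
noncomputable def symLift (t : Fin (n - 1) → G) (ht : SymRelations t) : Perm (Fin n) →* G where
  toFun σ := (pairMonoid_snd_surjective (t := t) σ).choose.1
  map_one' := pairMonoid_functional ht (y := 1)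
    (pairMonoid_snd_surjective (t := t) 1).choose_spec.1 (one_mem _)
    (pairMonoid_snd_surjective (t := t) 1).choose_spec.2
  map_mul' a b := by
    have ha := (pairMonoid_snd_surjective (t := t) a).choose_spec
    have hb := (pairMonoid_snd_surjective (t := t) b).choose_spec
    have hab := (pairMonoid_snd_surjective (t := t) (a * b)).choose_spec
    exact pairMonoid_functional ht hab.1 (mul_mem ha.1 hb.1)
      (by rw [hab.2, Prod.snd_mul, ha.2, hb.2])

@[simp]
theorem symLift_adjSwap (ht : SymRelations t) (i : Fin (n - 1)) :
    symLift t ht (adjSwap i) = t i :=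
  pairMonoid_functional ht (y := (t i, adjSwap i))
    (pairMonoid_snd_surjective (t := t) (adjSwap i)).choose_spec.1 (pair_mem i)
    (pairMonoid_snd_surjective (t := t) (adjSwap i)).choose_spec.2

end Lift

/-- Homomorphisms out of `S_n` that agree on the `τᵢ` are equal. -/
theorem hom_ext_adjSwap {M : Type*} [Monoid M] {n : ℕ} {f g : Perm (Fin n) →* M}
    (h : ∀ i, f (adjSwap i) = g (adjSwap i)) : f = g :=
  MonoidHom.eq_of_eqOn_denseM (closure_adjSwap n) (by rintro _ ⟨i, rfl⟩; exact h i)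

/-! ### The homomorphisms `θ`, `λ` and non-inner automorphisms of `S_6` -/

theorem vt_rho_relations (n : ℕ) : SymRelations (VT.rho (n := n)) where
  sq i := PresentedGroup.one_of_mem (VTRel.rho_sq i)
  comm i j h := mul_inv_eq_one.1 (PresentedGroup.one_of_mem (VTRel.rho_comm i j (Or.inl h)))
  braid i j h := mul_inv_eq_one.1 (PresentedGroup.one_of_mem (VTRel.rho_braid i j h))

/-- `λ : S_n → VT_n`, the homomorphism with `λ(τᵢ) = ρᵢ`. -/
noncomputable def vtLambda (n : ℕ) : Perm (Fin n) →* VT n :=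
  symLift VT.rho (vt_rho_relations n)

theorem vtLambda_adjSwap {n : ℕ} (i : Fin (n - 1)) : vtLambda n (adjSwap i) = VT.rho i :=
  symLift_adjSwap _ i

/-- The values of `θ` on the generators. -/
def thetaGen (n : ℕ) : VTGen n → Perm (Fin n)
  | VTGen.s _ => 1
  | VTGen.rho i => adjSwap i

theorem thetaGen_rel (n : ℕ) (r : FreeGroup (VTGen n)) (hr : VTRel n r) :
    FreeGroup.lift (thetaGen n) r = 1 := by
  have hA := adjSwap_relations n
  cases hr with
  | s_sq i => simp [sLetter, thetaGen]
  | s_comm i j h => simp [sLetter, thetaGen]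
  | rho_sq i => simpa [rhoLetter, thetaGen] using hA.sq i
  | rho_comm i j h =>
    rw [map_mul, map_inv, mul_inv_eq_one]
    simp only [rhoLetter, thetaGen, map_mul, FreeGroup.lift_apply_of]
    rcases h with h | h
    · exact hA.comm i j h
    · exact (hA.comm j i h).symm
  | rho_braid i j h =>
    rw [map_mul, map_inv, mul_inv_eq_one]
    simpa only [rhoLetter, thetaGen, map_mul, FreeGroup.lift_apply_of] using hA.braid i j h
  | rho_s_comm i j h => simp [sLetter, rhoLetter, thetaGen]
  | mixed i j h => simp [sLetter, rhoLetter, thetaGen]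

/-- `θ : VT_n → S_n`, the homomorphism with `θ(sᵢ) = 1` and `θ(ρᵢ) = τᵢ`. -/
def vtTheta (n : ℕ) : VT n →* Perm (Fin n) :=
  PresentedGroup.toGroup (f := thetaGen n) (thetaGen_rel n)

theorem vtTheta_s {n : ℕ} (i : Fin (n - 1)) : vtTheta n (VT.s i) = 1 :=
  PresentedGroup.toGroup.of _

theorem vtTheta_rho {n : ℕ} (i : Fin (n - 1)) : vtTheta n (VT.rho i) = adjSwap i :=
  PresentedGroup.toGroup.of _

theorem vtTheta_comp_vtLambda (n : ℕ) : (vtTheta n).comp (vtLambda n) = MonoidHom.id _ :=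
  hom_ext_adjSwap fun i => by simp [vtLambda_adjSwap, vtTheta_rho]

/-- The values on `τ₁, …, τ₅` of a non-inner involutive automorphism of `S_6`. -/
def nuGen : Fin 5 → Perm (Fin 6) :=
  ![swap 0 1 * swap 2 5 * swap 3 4,
    swap 0 3 * swap 1 2 * swap 4 5,
    swap 0 2 * swap 1 5 * swap 3 4,
    swap 0 1 * swap 2 3 * swap 4 5,
    swap 0 5 * swap 1 2 * swap 3 4]

theorem nuGen_relations : SymRelations nuGen where
  sq := by decide
  comm := by decide
  braid := by decide

/-- The endomorphism of `S_6` with these values. -/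
noncomputable def nuHom : Perm (Fin 6) →* Perm (Fin 6) := symLift (n := 6) nuGen nuGen_relations

theorem nuHom_adjSwap (i : Fin 5) : nuHom (adjSwap (n := 6) i) = nuGen i :=
  symLift_adjSwap (n := 6) _ i

/-- Words in the `τᵢ` for the values `nuGen`. -/
def nuWord : Fin 5 → List (Fin 5) :=
  ![[0, 2, 3, 4, 3, 2, 3],
    [0, 1, 2, 1, 0, 1, 4],
    [0, 1, 0, 1, 2, 3, 4, 3, 2, 1, 3],
    [0, 2, 4],
    [0, 1, 2, 3, 4, 3, 2, 1, 0, 1, 3]]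

set_option maxRecDepth 20000 in
theorem nuHom_comp_nuHom : nuHom.comp nuHom = MonoidHom.id _ := by
  refine hom_ext_adjSwap (n := 6) fun i => ?_
  have h1 : ∀ i : Fin 5, nuGen i = ((nuWord i).map (adjSwap (n := 6))).prod := by decide
  have h2 : ∀ i : Fin 5, ((nuWord i).map nuGen).prod = adjSwap (n := 6) i := by decide
  have h3 : (nuHom : Perm (Fin 6) → Perm (Fin 6)) ∘ adjSwap (n := 6) = nuGen :=
    funext nuHom_adjSwap
  rw [MonoidHom.comp_apply, nuHom_adjSwap, h1, map_list_prod, List.map_map, h3]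
  exact h2 i

/-- An automorphism is inner if it is conjugation by some element. -/
def IsInner {G : Type*} [Group G] (ν : MulAut G) : Prop := ∃ x : G, ν = MulAut.conj x

/-- Non-inner automorphisms of `S_6` exist, even involutive ones. -/
theorem exists_nonInner_involution :
    ∃ ν : MulAut (Perm (Fin 6)), ¬ IsInner ν ∧ orderOf ν = 2 := by
  have hni : ¬ IsInner (MonoidHom.toMulEquiv nuHom nuHom nuHom_comp_nuHom nuHom_comp_nuHom :
      MulAut (Perm (Fin 6))) := by
    rintro ⟨x, h⟩
    have h1 : nuGen 0 = x * adjSwap (n := 6) (0 : Fin 5) * x⁻¹ := by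
      rw [← nuHom_adjSwap]
      exact DFunLike.congr_fun h (adjSwap (n := 6) (0 : Fin 5))
    have h2 : (nuGen 0).support.card = 6 := by decide
    rw [h1, Perm.card_support_conj] at h2
    exact absurd h2 (by decide)
  refine ⟨_, hni, orderOf_eq_prime ?_ fun h => hni ⟨1, ?_⟩⟩
  · rw [sq]
    exact MulEquiv.ext fun σ => DFunLike.congr_fun nuHom_comp_nuHom σ
  · rw [h, map_one]

/-! ### Abelian and conjugate homomorphisms -/

/-- A homomorphism is abelian if its image is an abelian subgroup. -/
def MonoidHom.IsAbelianHom {G H : Type*} [Group G] [Group H] (f : G →* H) : Prop :=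
  ∀ a ∈ f.range, ∀ b ∈ f.range, a * b = b * a

/-- Two homomorphisms are conjugate if they differ by an inner automorphism of the target. -/
def ConjugateHoms {G H : Type*} [Group G] [Group H] (f g : G →* H) : Prop :=
  ∃ x : H, g = (MulAut.conj x).toMonoidHom.comp f

/-- For `n = m`, the identification of `S_n` with `S_m`. -/
def permCast {n m : ℕ} (h : n = m) : Perm (Fin n) →* Perm (Fin m) :=
  (finCongr h).permCongrHom.toMonoidHom

theorem permCast_rfl (n : ℕ) : permCast (rfl : n = n) = MonoidHom.id _ := rfl

/-!
The virtual twin group is a semidirect product: the kernel of `θ` is a right-angled Coxeter group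
whose generators `κ_p` (`kappa`) are indexed by the ordered pairs `p` of distinct points, with
`κ_p` and `κ_q` commuting exactly when `p = q` or `p` and `q` are disjoint, and `S_n` permutes the
indices. The proof only uses that the `κ_p` are involutions with these commutations and that
every element of `VT_n` is a product of some `κ_p` times an element of `λ(S_n)`
(`exists_reduced_eq`); faithfulness is replaced by a linear action.

The core is a fixed point theorem for a finite group `F` mapping to `VT_n`. Let `VT_n` act on
integer weights of the pairs, `κ_p` by a reflection that changes only the weight of `p`
(`weightReflection`) and `λ(S_n)` by permutation. A reduced word can only increase dominant
weights (`IsReducedWord.le_wordReflection`). In particular all elements of the orbit of the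
constant weight `1` are positive, so some element `x` of `VT_n` moves the sum of the `F`-orbit of
this weight to minimal total weight. The resulting weights `a` are dominant, positive and fixed by
the conjugate of `F` under `x`. If a reduced word times `λ(σ)` fixes `a`, then `σ` fixes `a`, and so
does each letter of the word; the `κ_p` that fix positive weights commute with each other
(`exists_conj_reduced`).

This has two consequences. If `F = S_n` maps by a section of `θ`, then `a` is invariant under `S_n`,
hence constant, no `κ_p` fixes it, all words are empty and the section is conjugate to `λ`
(`conjugateHoms_vtLambda`). If `F` maps to the kernel of `θ`, its image is commutative
(`commute_of_vtTheta_comp_eq_one`).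

For a homomorphism `φ : S_n → VT_m` with `n ≥ m` and `n ≥ 5`, either `θ ∘ φ` kills the alternating
group, which is perfect, so that `φ` kills it as well and is abelian; or `θ ∘ φ` is injective,
`n = m`, and `θ ∘ φ` is an automorphism `β` of `S_n`, so that `φ` is conjugate to `λ ∘ β`. It remains
to know the automorphisms of `S_n`: one that preserves transpositions is inner
(`isInner_of_isSwap`), comparing centralizers shows that only `S_6` has others
(`cycleType_map_isSwap`), and any two non-inner ones differ by an inner one
(`isInner_mul_inv_of_not_isInner`).
-/

/-! ### Reduced words of a right-angled Coxeter group -/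

section Words

variable {P : Type*} (Γ : SimpleGraph P)

/-- The letters that can be moved to the front of the word `l` by exchanging non-adjacent, hence
commuting, letters. -/
def frontLetters : List P → Set P
  | [] => ∅
  | p :: l => insert p {q ∈ frontLetters l | ¬ Γ.Adj p q}

/-- A word is reduced if no letter cancels against a later one. -/
def IsReducedWord : List P → Prop
  | [] => True
  | p :: l => p ∉ frontLetters Γ l ∧ IsReducedWord l

variable {Γ} {G : Type*} [Group G] {κ : P → G}

theorem exists_prod_eq_of_mem_frontLetters (hc : ∀ p q, ¬ Γ.Adj p q → κ p * κ q = κ q * κ p)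
    {l : List P} {p : P} (hp : p ∈ frontLetters Γ l) :
    ∃ l' : List P, l'.length + 1 = l.length ∧ (l.map κ).prod = κ p * (l'.map κ).prod := by
  induction l with
  | nil => exact absurd hp (Set.notMem_empty _)
  | cons q l ih =>
    rcases hp with rfl | ⟨hp, hadj⟩
    · exact ⟨l, rfl, by simp⟩
    · obtain ⟨l', h1, h2⟩ := ih hp
      refine ⟨q :: l', by simp [h1], ?_⟩
      rw [List.map_cons, List.prod_cons, h2, ← mul_assoc, hc q p hadj, List.map_cons,
        List.prod_cons, mul_assoc]

/-- Every product of letters is the product of a reduced word. -/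
theorem exists_isReducedWord (hs : ∀ p, κ p * κ p = 1)
    (hc : ∀ p q, ¬ Γ.Adj p q → κ p * κ q = κ q * κ p) (l : List P) :
    ∃ l' : List P, IsReducedWord Γ l' ∧ (l'.map κ).prod = (l.map κ).prod := by
  suffices h : ∃ l' : List P, IsReducedWord Γ l' ∧ l'.length ≤ l.length ∧
      (l'.map κ).prod = (l.map κ).prod by
    obtain ⟨l', h1, -, h2⟩ := h
    exact ⟨l', h1, h2⟩
  induction hn : l.length using Nat.strong_induction_on generalizing l with
  | h n ih =>
    cases l with
    | nil => exact ⟨[], trivial, by simp, rfl⟩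
    | cons p l =>
      simp only [List.length_cons] at hn
      obtain ⟨m, h1, h2, h3⟩ := ih l.length (by omega) l rfl
      by_cases hp : p ∈ frontLetters Γ m
      · obtain ⟨m', h4, h5⟩ := exists_prod_eq_of_mem_frontLetters hc hp
        obtain ⟨k, h6, h7, h8⟩ := ih m'.length (by omega) m' rfl
        refine ⟨k, h6, by omega, ?_⟩
        rw [h8, List.map_cons, List.prod_cons, ← h3, h5, ← mul_assoc, hs, one_mul]
      · exact ⟨p :: m, ⟨hp, h1⟩, by simp; omega, by simp [h3]⟩

end Words

/-! ### Reflections on integer vertex weights of a graph -/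

section Weights

variable {P : Type*} [Fintype P] (Γ : SimpleGraph P) [DecidableRel Γ.Adj]

/-- The sum of the weights `a` over the neighbours of `p`. -/
def nbrSum (a : P → ℤ) (p : P) : ℤ := ∑ q ∈ Γ.neighborFinset p, a q

theorem nbrSum_add (a b : P → ℤ) (p : P) : nbrSum Γ (a + b) p = nbrSum Γ a p + nbrSum Γ b p := by
  simp [nbrSum, Finset.sum_add_distrib]

/-- Weights with non-negative values that no reflection decreases. -/
structure IsDominant (a : P → ℤ) : Prop where
  nonneg : ∀ p, 0 ≤ a p
  le : ∀ p, a p ≤ 2 * nbrSum Γ a p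

variable {Γ} in
theorem le_nbrSum {a : P → ℤ} (ha : ∀ p, 0 ≤ a p) {p q : P} (h : Γ.Adj p q) :
    a q ≤ nbrSum Γ a p :=
  Finset.single_le_sum (f := a) (fun r _ => ha r) ((Γ.mem_neighborFinset _ _).2 h)

variable {Γ} in
/-- Adjacent vertices cannot both lie on the walls of positive weights: each weight would be at
least twice the other. -/
theorem not_adj_of_eq_two_mul_nbrSum {a : P → ℤ} (ha : ∀ p, 0 < a p) {p q : P}
    (hp : a p = 2 * nbrSum Γ a p) (hq : a q = 2 * nbrSum Γ a q) : ¬ Γ.Adj p q := by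
  intro h
  have h1 := le_nbrSum (fun r => (ha r).le) h
  have h2 := le_nbrSum (fun r => (ha r).le) h.symm
  have := ha p
  linarith

variable [DecidableEq P]

theorem nbrSum_update_of_not_adj {p q : P} (h : ¬ Γ.Adj p q) (a : P → ℤ) (x : ℤ) :
    nbrSum Γ (Function.update a q x) p = nbrSum Γ a p := by
  refine Finset.sum_congr rfl fun r hr => Function.update_of_ne ?_ _ _
  rintro rfl
  exact h ((Γ.mem_neighborFinset _ _).1 hr)

/-- The reflection in the vertex `p` on integer weights: the weight `a p` becomes
`4 * nbrSum Γ a p - a p` and all other weights stay. It is the canonical reflection of a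
right-angled Coxeter group whose non-commuting pairs of generators are the edges of `Γ`, with
the entries `-2` in place of the usual `-1` in the bilinear form. -/
def weightReflection (p : P) : (P → ℤ) ≃ₗ[ℤ] (P → ℤ) where
  toFun a := Function.update a p (4 * nbrSum Γ a p - a p)
  invFun a := Function.update a p (4 * nbrSum Γ a p - a p)
  left_inv a := by
    simp [nbrSum_update_of_not_adj Γ (Γ.loopless.irrefl p)]
  right_inv a := by
    simp [nbrSum_update_of_not_adj Γ (Γ.loopless.irrefl p)]
  map_add' a b := by
    rw [nbrSum_add]
    ext q
    rcases eq_or_ne q p with rfl | h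
    · simp; ring
    · simp [h]
  map_smul' c a := by
    ext q
    rcases eq_or_ne q p with rfl | h
    · simp [nbrSum, ← Finset.mul_sum]; ring
    · simp [h]

theorem weightReflection_apply (p : P) (a : P → ℤ) :
    weightReflection Γ p a = Function.update a p (4 * nbrSum Γ a p - a p) := rfl

theorem weightReflection_mul_self (p : P) :
    weightReflection Γ p * weightReflection Γ p = 1 :=
  LinearEquiv.ext (weightReflection Γ p).left_inv

theorem weightReflection_comm {p q : P} (h : ¬ Γ.Adj p q) :
    weightReflection Γ p * weightReflection Γ q =
      weightReflection Γ q * weightReflection Γ p := by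
  rcases eq_or_ne p q with rfl | hpq
  · rfl
  refine LinearEquiv.ext fun a => ?_
  simp only [LinearEquiv.mul_apply, weightReflection_apply]
  rw [nbrSum_update_of_not_adj Γ h, nbrSum_update_of_not_adj Γ (fun h' => h h'.symm),
    Function.update_of_ne hpq, Function.update_of_ne hpq.symm, Function.update_comm hpq]

/-- The action of a word on weights, its last letter acting first. -/
def wordReflection (l : List P) : (P → ℤ) ≃ₗ[ℤ] (P → ℤ) := (l.map (weightReflection Γ)).prod

theorem wordReflection_cons (p : P) (l : List P) (a : P → ℤ) :
    wordReflection Γ (p :: l) a = weightReflection Γ p (wordReflection Γ l a) := by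
  simp [wordReflection]

variable {Γ}

theorem le_weightReflection {a : P → ℤ} {p : P} (h : a p ≤ 2 * nbrSum Γ a p) :
    a ≤ weightReflection Γ p a := by
  intro q
  rw [weightReflection_apply]
  rcases eq_or_ne q p with rfl | hq
  · simp; linarith
  · simp [hq]

/-- A reduced word can only increase dominant weights, and the inequality of dominance survives
at the letters that are not in front. For a neighbour `q` of the last reflected vertex `p` it
survives because the new weight at `p` is at least twice the sum of the weights of its
neighbours, in particular at least twice the weight at `q`. -/
theorem IsReducedWord.le_wordReflection {l : List P} (hl : IsReducedWord Γ l) {a : P → ℤ}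
    (ha : IsDominant Γ a) : a ≤ wordReflection Γ l a ∧
      ∀ q ∉ frontLetters Γ l, wordReflection Γ l a q ≤ 2 * nbrSum Γ (wordReflection Γ l a) q := by
  induction l with
  | nil => exact ⟨le_rfl, fun q _ => ha.le q⟩
  | cons p l ih =>
    obtain ⟨h1, h2⟩ := ih hl.2
    rw [wordReflection_cons]
    set b := wordReflection Γ l a
    have hp := h2 p hl.1
    have hle := le_weightReflection hp
    refine ⟨h1.trans hle, fun q hq => ?_⟩
    have hb : ∀ r, 0 ≤ b r := fun r => (ha.nonneg r).trans (h1 r)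
    have hqp : q ≠ p := fun h => hq (h ▸ Set.mem_insert _ _)
    have hbq : weightReflection Γ p b q = b q := by simp [weightReflection_apply, hqp]
    by_cases hadj : Γ.Adj p q
    · have h3 := le_nbrSum (fun r => (hb r).trans (hle r)) hadj.symm
      have h4 := le_nbrSum hb hadj
      have h5 : weightReflection Γ p b p = 4 * nbrSum Γ b p - b p := by
        simp [weightReflection_apply]
      have h6 := hb q
      rw [hbq]
      linarith
    · rw [hbq, weightReflection_apply, nbrSum_update_of_not_adj Γ fun h => hadj h.symm]
      exact h2 q fun h => hq (Set.mem_insert_of_mem _ ⟨h, hadj⟩)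

/-- If a reduced word fixes dominant weights then each of its letters does. -/
theorem IsReducedWord.eq_two_mul_nbrSum {l : List P} (hl : IsReducedWord Γ l) {a : P → ℤ}
    (ha : IsDominant Γ a) (hfix : wordReflection Γ l a = a) :
    ∀ p ∈ l, a p = 2 * nbrSum Γ a p := by
  induction l with
  | nil => simp
  | cons p l ih =>
    obtain ⟨h1, h2⟩ := hl.2.le_wordReflection ha
    rw [wordReflection_cons] at hfix
    have hle := le_weightReflection (h2 p hl.1)
    have hb : wordReflection Γ l a = a := le_antisymm (hle.trans hfix.le) h1
    rw [hb] at hfix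
    have hp : a p = 2 * nbrSum Γ a p := by
      have := congrFun hfix p
      simp only [weightReflection_apply, Function.update_self] at this
      linarith
    rintro q (_ | ⟨_, hq⟩)
    · exact hp
    · exact ih hl.2 hb q hq

end Weights

/-! ### Ordered pairs of points -/

/-- The ordered pairs of distinct points of `Fin n`. -/
abbrev OrdPair (n : ℕ) : Type := {p : Fin n × Fin n // p.1 ≠ p.2}

section OrdPair

variable {n : ℕ}

instance : MulAction (Perm (Fin n)) (OrdPair n) where
  smul σ p := ⟨(σ p.1.1, σ p.1.2), fun h => p.2 (σ.injective h)⟩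
  one_smul _ := rfl
  mul_smul _ _ _ := rfl

theorem OrdPair.smul_fst (σ : Perm (Fin n)) (p : OrdPair n) : (σ • p).1.1 = σ p.1.1 := rfl

theorem OrdPair.smul_snd (σ : Perm (Fin n)) (p : OrdPair n) : (σ • p).1.2 = σ p.1.2 := rfl

theorem OrdPair.two_le (p : OrdPair n) : 2 ≤ n := by
  have h := p.2
  have h1 := p.1.1.2
  have h2 := p.1.2.2
  rw [Ne, Fin.ext_iff] at h
  omega

/-- Two different ordered pairs are adjacent if they have a point in common. -/
def pairGraph (n : ℕ) : SimpleGraph (OrdPair n) where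
  Adj p q := p ≠ q ∧ (p.1.1 = q.1.1 ∨ p.1.1 = q.1.2 ∨ p.1.2 = q.1.1 ∨ p.1.2 = q.1.2)
  symm := ⟨fun p q h => ⟨h.1.symm, by have := h.2; tauto⟩⟩
  loopless := ⟨fun p h => h.1 rfl⟩

instance : DecidableRel (pairGraph n).Adj := fun p q =>
  inferInstanceAs (Decidable (p ≠ q ∧ _))

theorem pairGraph_adj_smul (σ : Perm (Fin n)) (p q : OrdPair n) :
    (pairGraph n).Adj (σ • p) (σ • q) ↔ (pairGraph n).Adj p q := by
  simp only [pairGraph, OrdPair.smul_fst, OrdPair.smul_snd, σ.injective.eq_iff, Ne,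
    MulAction.injective σ |>.eq_iff]

theorem exists_pairGraph_adj (p : OrdPair n) : ∃ q, (pairGraph n).Adj p q := by
  refine ⟨⟨(p.1.2, p.1.1), p.2.symm⟩, fun h => p.2 ?_, by simp⟩
  exact congrArg (fun q : OrdPair n => q.1.1) h

/-- The pair `(i, i + 1)`. -/
def adjPair (i : Fin (n - 1)) : OrdPair n :=
  ⟨(⟨i, by omega⟩, ⟨(i : ℕ) + 1, by omega⟩), by simp [Fin.ext_iff]⟩

theorem exists_smul_eq_ordPair (p q : OrdPair n) : ∃ σ : Perm (Fin n), σ • p = q := by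
  obtain ⟨σ, hσ⟩ := Equiv.Perm.exists_extending_pair ![p.1.1, p.1.2] ![q.1.1, q.1.2]
    (by rw [Function.Injective]; simp [Fin.forall_fin_two, p.2, p.2.symm])
    (by rw [Function.Injective]; simp [Fin.forall_fin_two, q.2, q.2.symm])
  exact ⟨σ, Subtype.ext (Prod.ext (hσ 0) (hσ 1))⟩

theorem exists_smul_eq_smul_eq {p q p' q' : OrdPair n} (hne : p ≠ q) (hne' : p' ≠ q')
    (h : ¬ (pairGraph n).Adj p q) (h' : ¬ (pairGraph n).Adj p' q') :
    ∃ σ : Perm (Fin n), σ • p = p' ∧ σ • q = q' := by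
  have key : ∀ {p q : OrdPair n}, p ≠ q → ¬ (pairGraph n).Adj p q →
      Function.Injective ![p.1.1, p.1.2, q.1.1, q.1.2] := by
    intro p q hne h
    have hp := p.2
    have hq := q.2
    simp only [pairGraph, not_and, not_or] at h
    obtain ⟨h1, h2, h3, h4⟩ := h hne
    intro i j
    fin_cases i <;> fin_cases j <;> simp [*, Ne.symm, eq_comm] <;> grind
  obtain ⟨σ, hσ⟩ := Equiv.Perm.exists_extending_pair _ _ (key hne h) (key hne' h')
  exact ⟨σ, Subtype.ext (Prod.ext (hσ 0) (hσ 1)), Subtype.ext (Prod.ext (hσ 2) (hσ 3))⟩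

/-! ### The action of the virtual twin group on weights of pairs -/

/-- The action of permutations on the weights of pairs. -/
def permWeights (n : ℕ) : Perm (Fin n) →* ((OrdPair n → ℤ) ≃ₗ[ℤ] (OrdPair n → ℤ)) where
  toFun σ := LinearEquiv.funCongrLeft ℤ ℤ (MulAction.toPerm σ⁻¹)
  map_one' := by ext; simp
  map_mul' σ τ := by
    refine LinearEquiv.ext fun a => funext fun p => ?_
    simp [LinearEquiv.funCongrLeft_apply, LinearMap.funLeft_apply, mul_smul]

theorem permWeights_apply (σ : Perm (Fin n)) (a : OrdPair n → ℤ) (p : OrdPair n) :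
    permWeights n σ a p = a (σ⁻¹ • p) := rfl

theorem nbrSum_permWeights (σ : Perm (Fin n)) (a : OrdPair n → ℤ) (p : OrdPair n) :
    nbrSum (pairGraph n) (permWeights n σ a) p = nbrSum (pairGraph n) a (σ⁻¹ • p) := by
  refine Finset.sum_equiv (MulAction.toPerm σ⁻¹) (fun q => ?_) fun q _ => rfl
  simp only [SimpleGraph.mem_neighborFinset, MulAction.toPerm_apply]
  exact (pairGraph_adj_smul _ _ _).symm

theorem permWeights_mul_weightReflection (σ : Perm (Fin n)) (p : OrdPair n) :
    permWeights n σ * weightReflection (pairGraph n) p =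
      weightReflection (pairGraph n) (σ • p) * permWeights n σ := by
  refine LinearEquiv.ext fun a => funext fun q => ?_
  simp only [LinearEquiv.mul_apply, weightReflection_apply, permWeights_apply,
    nbrSum_permWeights, inv_smul_smul]
  rcases eq_or_ne q (σ • p) with rfl | h
  · simp
  · rw [Function.update_of_ne h, Function.update_of_ne, permWeights_apply]
    rwa [Ne, inv_smul_eq_iff]

theorem IsDominant.permWeights {a : OrdPair n → ℤ} (ha : IsDominant (pairGraph n) a)
    (σ : Perm (Fin n)) : IsDominant (pairGraph n) (permWeights n σ a) where
  nonneg _ := ha.nonneg _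
  le p := by rw [nbrSum_permWeights]; exact ha.le _

/-- The images of the generators of `VT_n` under the action on weights: `sᵢ` acts as the
reflection in the pair `(i, i + 1)` and `ρᵢ` as the transposition of `i` and `i + 1`. -/
def vtWeightsGen (n : ℕ) : VTGen n → ((OrdPair n → ℤ) ≃ₗ[ℤ] (OrdPair n → ℤ))
  | VTGen.s i => weightReflection (pairGraph n) (adjPair i)
  | VTGen.rho i => permWeights n (adjSwap i)

theorem not_adj_adjPair {i j : Fin (n - 1)} (h : FarApart i j) :
    ¬ (pairGraph n).Adj (adjPair i) (adjPair j) := by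
  rintro ⟨-, h'⟩
  simp only [adjPair, Fin.mk.injEq] at h'
  unfold FarApart at h
  omega

theorem adjPair_ne {i j : Fin (n - 1)} (h : FarApart i j) : adjPair i ≠ adjPair j := by
  intro h'
  have := congrArg (fun q : OrdPair n => (q.1.1 : ℕ)) h'
  simp only [adjPair] at this
  unfold FarApart at h
  omega

theorem adjSwap_smul_adjPair_of_farApart {i j : Fin (n - 1)} (h : FarApart i j) :
    adjSwap i • adjPair j = adjPair j := by
  unfold FarApart at h
  refine Subtype.ext (Prod.ext ?_ ?_) <;> rw [Fin.ext_iff] <;>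
    simp only [OrdPair.smul_fst, OrdPair.smul_snd, adjPair, adjSwap] <;>
    rw [swap_apply_of_ne_of_ne] <;> simp only [Ne, Fin.mk.injEq] <;> omega

theorem adjSwap_mul_adjSwap_smul_adjPair {i j : Fin (n - 1)} (h : (j : ℕ) = i + 1) :
    (adjSwap i * adjSwap j) • adjPair i = adjPair j := by
  obtain ⟨i, hi⟩ := i
  obtain ⟨j, hj⟩ := j
  simp only at h
  subst h
  refine Subtype.ext (Prod.ext ?_ ?_) <;>
    simp only [OrdPair.smul_fst, OrdPair.smul_snd, adjPair, adjSwap, Perm.mul_apply,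
      swap_apply_def, Fin.ext_iff, apply_ite Fin.val] <;> grind

theorem vtWeightsGen_rel (n : ℕ) (r : FreeGroup (VTGen n)) (hr : VTRel n r) :
    FreeGroup.lift (vtWeightsGen n) r = 1 := by
  have hA := adjSwap_relations n
  cases hr with
  | s_sq i => simpa [sLetter, vtWeightsGen] using weightReflection_mul_self _ _
  | s_comm i j h =>
    rw [map_mul, map_inv, mul_inv_eq_one]
    simpa only [sLetter, vtWeightsGen, map_mul, FreeGroup.lift_apply_of] using
      weightReflection_comm _ (not_adj_adjPair h)
  | rho_sq i =>
    simp only [rhoLetter, vtWeightsGen, map_mul, FreeGroup.lift_apply_of]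
    rw [← map_mul, hA.sq, map_one]
  | rho_comm i j h =>
    rw [map_mul, map_inv, mul_inv_eq_one]
    simp only [rhoLetter, vtWeightsGen, map_mul, FreeGroup.lift_apply_of]
    rw [← map_mul, ← map_mul]
    rcases h with h | h
    · rw [hA.comm i j h]
    · rw [hA.comm j i h]
  | rho_braid i j h =>
    rw [map_mul, map_inv, mul_inv_eq_one]
    simp only [rhoLetter, vtWeightsGen, map_mul, FreeGroup.lift_apply_of]
    simp only [← map_mul, hA.braid i j h]
  | rho_s_comm i j h =>
    rw [map_mul, map_inv, mul_inv_eq_one]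
    simp only [rhoLetter, sLetter, vtWeightsGen, map_mul, FreeGroup.lift_apply_of]
    rw [permWeights_mul_weightReflection, adjSwap_smul_adjPair_of_farApart h]
  | mixed i j h =>
    rw [map_mul, map_inv, mul_inv_eq_one]
    simp only [rhoLetter, sLetter, vtWeightsGen, map_mul, FreeGroup.lift_apply_of]
    rw [← map_mul, permWeights_mul_weightReflection, adjSwap_mul_adjSwap_smul_adjPair h,
      map_mul, mul_assoc]

/-- The action of `VT_n` on the weights of pairs. -/
def vtWeights (n : ℕ) : VT n →* ((OrdPair n → ℤ) ≃ₗ[ℤ] (OrdPair n → ℤ)) :=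
  PresentedGroup.toGroup (f := vtWeightsGen n) (vtWeightsGen_rel n)

theorem vtWeights_s (i : Fin (n - 1)) :
    vtWeights n (VT.s i) = weightReflection (pairGraph n) (adjPair i) :=
  PresentedGroup.toGroup.of _

theorem vtWeights_vtLambda (σ : Perm (Fin n)) :
    vtWeights n (vtLambda n σ) = permWeights n σ := by
  have : (vtWeights n).comp (vtLambda n) = permWeights n := hom_ext_adjSwap fun i => by
    rw [MonoidHom.comp_apply, vtLambda_adjSwap]
    exact PresentedGroup.toGroup.of _
  exact DFunLike.congr_fun this σ

end OrdPair

/-! ### The kernel generators of the virtual twin group -/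

theorem mem_closure_of_apply_eq {G : Type*} [Group G] {n : ℕ} {t : Fin (n - 1) → G}
    (ht : SymRelations t) {k : ℕ} (hk : k + 1 < n) {x : G × Perm (Fin n)}
    (hx : x ∈ Submonoid.closure (pairSeq t '' Set.Iio (k + 1)))
    (h : x.2 ⟨k + 1, hk⟩ = ⟨k + 1, hk⟩) : x ∈ Submonoid.closure (pairSeq t '' Set.Iio k) := by
  obtain ⟨y, hy, j, d, hjd, rfl⟩ := closure_decomp (N := n - 1)
    (fun i _ => pairSeq_sq ht i) (fun i j h _ => pairSeq_comm ht i j h)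
    (fun i h => pairSeq_braid ht i h) (by omega) hx
  have hap := descProd_pairSeq_apply (t := t) j d (by omega) (by omega)
  have hfix := closure_fixes k hy ⟨k + 1, hk⟩ (by simp)
  simp only [hjd] at hap
  rw [Prod.snd_mul, Perm.mul_apply] at h
  have h1 := y.2.injective (h.trans hfix.symm)
  have h2 := (descProd (pairSeq t) j d).2.injective (h1.trans hap.symm)
  rw [Fin.mk.injEq] at h2
  obtain rfl : d = 0 := by omega
  simpa [descProd] using hy

theorem symLift_mem_pairMonoid {G : Type*} [Group G] {n : ℕ} {t : Fin (n - 1) → G}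
    (ht : SymRelations t) (σ : Perm (Fin n)) : (symLift t ht σ, σ) ∈ pairMonoid t := by
  have h := (pairMonoid_snd_surjective (t := t) σ).choose_spec
  exact (Prod.ext rfl h.2 : (pairMonoid_snd_surjective (t := t) σ).choose =
    (symLift t ht σ, σ)) ▸ h.1

section Kappa

variable {n : ℕ}

/-- The index of the last generators. -/
def lastIndex (hn : 2 ≤ n) : Fin (n - 1) := ⟨n - 2, by omega⟩

/-- A permutation that fixes the last two points is a product of the `τᵢ` that do not move
them, and the corresponding `ρᵢ` commute with the last `sᵢ`. -/
theorem vtLambda_commute_s_last (hn : 2 ≤ n) {σ : Perm (Fin n)}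
    (hσ : σ • adjPair (lastIndex hn) = adjPair (lastIndex hn)) :
    Commute (vtLambda n σ) (VT.s (lastIndex hn)) := by
  have h1 : σ ⟨n - 2, by omega⟩ = ⟨n - 2, by omega⟩ :=
    congrArg (fun q : OrdPair n => q.1.1) hσ
  have h2 : σ ⟨n - 2 + 1, by omega⟩ = ⟨n - 2 + 1, by omega⟩ :=
    congrArg (fun q : OrdPair n => q.1.2) hσ
  have ht := vt_rho_relations n
  have hx : (vtLambda n σ, σ) ∈ Submonoid.closure (pairSeq VT.rho '' Set.Iio (n - 1)) :=
    symLift_mem_pairMonoid ht σ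
  have hx' : (vtLambda n σ, σ) ∈ Submonoid.closure (pairSeq VT.rho '' Set.Iio (n - 2)) :=
    mem_closure_of_apply_eq ht (k := n - 2) (by omega)
      (by rwa [show n - 2 + 1 = n - 1 by omega]) h2
  have hx'' : (vtLambda n σ, σ) ∈ Submonoid.closure (pairSeq VT.rho '' Set.Iio (n - 3)) := by
    rcases Nat.lt_or_ge 2 n with h | h
    · have h3 : n - 3 + 1 = n - 2 := by omega
      refine mem_closure_of_apply_eq ht (k := n - 3) (by omega) (by rwa [h3]) ?_
      simp only [h3, h1]
    · rwa [show n - 3 = n - 2 by omega]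
  have key : ∀ x : VT n × Perm (Fin n),
      x ∈ Submonoid.closure (pairSeq VT.rho '' Set.Iio (n - 3)) →
        Commute x.1 (VT.s (lastIndex hn)) := by
    intro x hx
    induction hx using Submonoid.closure_induction with
    | mem z hz =>
      obtain ⟨i, hi, rfl⟩ := hz
      simp only [Set.mem_Iio] at hi
      rw [pairSeq, dif_pos (by omega)]
      exact mul_inv_eq_one.1 (PresentedGroup.one_of_mem
        (VTRel.rho_s_comm _ _ (Or.inl (by simp only [lastIndex]; omega))))
    | one => exact Commute.one_left _
    | mul a b _ _ ha hb => exact ha.mul_left hb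
  exact key (vtLambda n σ, σ) hx''

/-- The generator `κ_p` of the kernel of `θ`, for an ordered pair `p = (a, b)`: the conjugate
of the last `sᵢ` under `λ(σ)`, for any permutation `σ` that moves the last two points, in this
order, to `a` and `b`. -/
noncomputable def kappa (p : OrdPair n) : VT n :=
  MulAut.conj (vtLambda n (exists_smul_eq_ordPair (adjPair (lastIndex p.two_le)) p).choose)
    (VT.s (lastIndex p.two_le))

theorem kappa_smul_last (hn : 2 ≤ n) (σ : Perm (Fin n)) :
    kappa (σ • adjPair (lastIndex hn)) = MulAut.conj (vtLambda n σ) (VT.s (lastIndex hn)) := by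
  unfold kappa
  set τ := (exists_smul_eq_ordPair (adjPair (lastIndex hn))
    (σ • adjPair (lastIndex hn))).choose with hτ
  have h : τ • adjPair (lastIndex hn) = σ • adjPair (lastIndex hn) :=
    (exists_smul_eq_ordPair (adjPair (lastIndex hn)) (σ • adjPair (lastIndex hn))).choose_spec
  have h' : (σ⁻¹ * τ) • adjPair (lastIndex hn) = adjPair (lastIndex hn) := by
    rw [mul_smul, h, inv_smul_smul]
  have h2 := (vtLambda_commute_s_last hn h').eq
  have h3 : τ = σ * (σ⁻¹ * τ) := by group
  rw [h3, map_mul, map_mul, MulAut.mul_apply]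
  congr 1
  rw [MulAut.conj_apply, h2, mul_inv_cancel_right]

theorem kappa_smul (σ : Perm (Fin n)) (p : OrdPair n) :
    kappa (σ • p) = MulAut.conj (vtLambda n σ) (kappa p) := by
  have hn := p.two_le
  obtain ⟨τ, rfl⟩ := exists_smul_eq_ordPair (adjPair (lastIndex hn)) p
  rw [← mul_smul, kappa_smul_last, kappa_smul_last, map_mul, map_mul, MulAut.mul_apply]

theorem kappa_adjPair (i : Fin (n - 1)) : kappa (adjPair i) = VT.s i := by
  obtain ⟨i, hi⟩ := i
  have hn : 2 ≤ n := by omega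
  induction hd : n - 2 - i generalizing i with
  | zero =>
    obtain rfl : i = n - 2 := by omega
    have := kappa_smul_last hn 1
    rwa [one_smul, map_one, map_one] at this
  | succ d ih =>
    have hi' : i + 1 < n - 1 := by omega
    have h1 := ih (i + 1) hi' (by omega)
    rw [← adjSwap_mul_adjSwap_smul_adjPair (i := ⟨i, hi⟩) (j := ⟨i + 1, hi'⟩) rfl,
      kappa_smul, map_mul, vtLambda_adjSwap, vtLambda_adjSwap] at h1
    have h2 : VT.rho ⟨i, hi⟩ * VT.rho ⟨i + 1, hi'⟩ * VT.s ⟨i, hi⟩ =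
        VT.s ⟨i + 1, hi'⟩ * VT.rho ⟨i, hi⟩ * VT.rho ⟨i + 1, hi'⟩ :=
      mul_inv_eq_one.1 (PresentedGroup.one_of_mem (VTRel.mixed ⟨i, hi⟩ ⟨i + 1, hi'⟩ rfl))
    rw [mul_assoc (VT.s _), ← eq_mul_inv_iff_mul_eq.trans eq_comm] at h2
    refine (MulAut.conj (VT.rho ⟨i, hi⟩ * VT.rho ⟨i + 1, hi'⟩)).injective (h1.trans ?_)
    rw [MulAut.conj_apply, ← h2]

theorem s_mul_self (i : Fin (n - 1)) : (VT.s i : VT n) * VT.s i = 1 :=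
  PresentedGroup.one_of_mem (VTRel.s_sq i)

theorem kappa_mul_self (p : OrdPair n) : kappa p * kappa p = 1 := by
  rw [kappa, ← map_mul, s_mul_self, map_one]

theorem kappa_comm (p q : OrdPair n) (h : ¬ (pairGraph n).Adj p q) :
    kappa p * kappa q = kappa q * kappa p := by
  rcases eq_or_ne p q with rfl | hne
  · rfl
  -- Disjoint pairs involve four points.
  have hn : 4 ≤ n := by
    have hp := p.2
    have hq := q.2
    simp only [pairGraph, not_and, not_or] at h
    have := h hne
    simp only [Ne, Fin.ext_iff] at *
    omega
  have hfar : FarApart (⟨0, by omega⟩ : Fin (n - 1)) ⟨2, by omega⟩ := Or.inl le_rfl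
  obtain ⟨σ, rfl, rfl⟩ := exists_smul_eq_smul_eq (adjPair_ne hfar) hne (not_adj_adjPair hfar) h
  rw [kappa_smul, kappa_smul, ← map_mul, ← map_mul, kappa_adjPair, kappa_adjPair]
  exact congrArg _ (mul_inv_eq_one.1 (PresentedGroup.one_of_mem (VTRel.s_comm _ _ hfar)))

theorem vtTheta_kappa (p : OrdPair n) : vtTheta n (kappa p) = 1 := by
  simp [kappa, vtTheta_s]

theorem vtTheta_vtLambda (σ : Perm (Fin n)) : vtTheta n (vtLambda n σ) = σ :=
  DFunLike.congr_fun (vtTheta_comp_vtLambda n) σ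

theorem vtWeights_kappa (p : OrdPair n) :
    vtWeights n (kappa p) = weightReflection (pairGraph n) p := by
  have hn := p.two_le
  obtain ⟨σ, rfl⟩ := exists_smul_eq_ordPair (adjPair (lastIndex hn)) p
  rw [kappa_smul, kappa_adjPair, MulAut.conj_apply, map_mul, map_mul, vtWeights_s, map_inv,
    vtWeights_vtLambda, permWeights_mul_weightReflection, mul_inv_cancel_right]

theorem vtLambda_mul_prod_kappa (σ : Perm (Fin n)) (l : List (OrdPair n)) :
    vtLambda n σ * (l.map kappa).prod =
      ((l.map (σ • ·)).map kappa).prod * vtLambda n σ := by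
  induction l with
  | nil => simp
  | cons p l ih =>
    rw [List.map_cons, List.prod_cons, List.map_cons, List.map_cons, List.prod_cons, kappa_smul,
      mul_assoc, ← ih, MulAut.conj_apply]
    group

theorem exists_eq_prod_kappa_mul (g : VT n) :
    ∃ (l : List (OrdPair n)) (σ : Perm (Fin n)), g = (l.map kappa).prod * vtLambda n σ := by
  have hgen : ∀ x : VTGen n, ∃ (l : List (OrdPair n)) (σ : Perm (Fin n)),
      PresentedGroup.of (rels := {r | VTRel n r}) x = (l.map kappa).prod * vtLambda n σ := by
    rintro (i | i)
    · exact ⟨[adjPair i], 1, by simp [kappa_adjPair]; rfl⟩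
    · exact ⟨[], adjSwap i, by simp [vtLambda_adjSwap]; rfl⟩
  have hinv : ∀ x : VTGen n, (PresentedGroup.of (rels := {r | VTRel n r}) x)⁻¹ =
      PresentedGroup.of x := by
    rintro (i | i)
    · exact inv_eq_of_mul_eq_one_left (s_mul_self i)
    · exact inv_eq_of_mul_eq_one_left ((vt_rho_relations n).sq i)
  induction g using PresentedGroup.induction_on with
  | _ w =>
    induction w using FreeGroup.induction_on with
    | C1 => exact ⟨[], 1, by simp⟩
    | of x => exact hgen x
    | inv_of x _ => rw [map_inv]; exact (hinv x).symm ▸ hgen x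
    | mul a b ha hb =>
      obtain ⟨l, σ, h1⟩ := ha
      obtain ⟨m, τ, h2⟩ := hb
      refine ⟨l ++ m.map (σ • ·), σ * τ, ?_⟩
      rw [map_mul, h1, h2, mul_assoc, ← mul_assoc (vtLambda n σ), vtLambda_mul_prod_kappa]
      simp [mul_assoc]

/-- Every element of `VT_n` is a reduced word in the `κ_p` times an element of `λ(S_n)`. -/
theorem exists_reduced_eq (g : VT n) :
    ∃ (l : List (OrdPair n)) (σ : Perm (Fin n)), IsReducedWord (pairGraph n) l ∧
      g = (l.map kappa).prod * vtLambda n σ := by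
  obtain ⟨l, σ, rfl⟩ := exists_eq_prod_kappa_mul g
  obtain ⟨m, hm, h⟩ := exists_isReducedWord kappa_mul_self kappa_comm l
  exact ⟨m, σ, hm, by rw [h]⟩

theorem vtTheta_prod_kappa_mul (l : List (OrdPair n)) (σ : Perm (Fin n)) :
    vtTheta n ((l.map kappa).prod * vtLambda n σ) = σ := by
  rw [map_mul, vtTheta_vtLambda, map_list_prod, List.map_map, List.prod_eq_one, one_mul]
  simp only [List.mem_map, Function.comp_apply, vtTheta_kappa]
  rintro _ ⟨_, _, rfl⟩
  rfl

theorem vtWeights_prod_kappa_mul (l : List (OrdPair n)) (σ : Perm (Fin n))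
    (a : OrdPair n → ℤ) :
    vtWeights n ((l.map kappa).prod * vtLambda n σ) a =
      wordReflection (pairGraph n) l (permWeights n σ a) := by
  rw [map_mul, vtWeights_vtLambda, map_list_prod, List.map_map, LinearEquiv.mul_apply,
    wordReflection]
  congr 3
  exact funext vtWeights_kappa

end Kappa

/-! ### Finite subgroups -/

section FixedPoint

variable {n : ℕ}

theorem isDominant_one : IsDominant (pairGraph n) 1 where
  nonneg _ := zero_le_one
  le p := by
    obtain ⟨q, hq⟩ := exists_pairGraph_adj p
    have := le_nbrSum (a := 1) (fun _ => zero_le_one) hq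
    simp only [Pi.one_apply] at this ⊢
    linarith

theorem one_le_vtWeights (g : VT n) (p : OrdPair n) : 1 ≤ vtWeights n g 1 p := by
  obtain ⟨l, σ, hl, rfl⟩ := exists_reduced_eq g
  rw [vtWeights_prod_kappa_mul]
  exact (hl.le_wordReflection isDominant_one).1 p

/-- A finite group acting through `VT_n` on weights fixes, after conjugation, positive dominant
weights: sum the orbit of the constant weight `1` and move the sum to minimal total weight. -/
theorem exists_fixed_weights {F : Type*} [Group F] [Finite F] (φ : F →* VT n) :
    ∃ (x : VT n) (a : OrdPair n → ℤ), (∀ p, 0 < a p) ∧ IsDominant (pairGraph n) a ∧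
      ∀ f, vtWeights n (x * φ f * x⁻¹) a = a := by
  classical
  have := Fintype.ofFinite F
  set b : OrdPair n → ℤ := ∑ f, vtWeights n (φ f) 1 with hb
  have hfix : ∀ f, vtWeights n (φ f) b = b := by
    intro f
    rw [hb, map_sum]
    refine Fintype.sum_equiv (Equiv.mulLeft f) _ _ fun g => ?_
    simp
  have hpos : ∀ x p, 0 < vtWeights n x b p := by
    intro x p
    rw [hb, map_sum, Finset.sum_apply]
    refine Finset.sum_pos (fun f _ => ?_) ⟨1, Finset.mem_univ _⟩
    have := one_le_vtWeights (x * φ f) p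
    rw [map_mul, LinearEquiv.mul_apply] at this
    linarith
  let S : VT n → ℤ := fun x => ∑ p, vtWeights n x b p
  have hS : ∀ x, 0 ≤ S x := fun x => Finset.sum_nonneg fun p _ => (hpos x p).le
  set x := Function.argmin fun x => (S x).toNat
  refine ⟨x, vtWeights n x b, hpos x, ⟨fun p => (hpos x p).le, fun p => ?_⟩, fun f => ?_⟩
  · have h1 : (S x).toNat ≤ (S (kappa p * x)).toNat := Function.argmin_le (fun x => (S x).toNat) _
    have h2 : S x ≤ S (kappa p * x) := by
      have := hS x
      have := hS (kappa p * x)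
      omega
    simp only [S, map_mul, vtWeights_kappa, LinearEquiv.mul_apply, weightReflection_apply] at h2
    rw [Finset.sum_update_of_mem (Finset.mem_univ p),
      ← Finset.add_sum_erase _ _ (Finset.mem_univ p), ← Finset.sdiff_singleton_eq_erase] at h2
    linarith
  · simp only [map_mul, LinearEquiv.mul_apply]
    rw [← LinearEquiv.mul_apply (vtWeights n x⁻¹), ← map_mul, inv_mul_cancel, map_one,
      LinearEquiv.coe_one, id, hfix]

/-- The image of a finite group in `VT_n` can be conjugated so that, for some positive weights `a`,
each of its elements is a word in letters `κ_p` that fix `a` times a permutation that fixes `a`. -/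
theorem exists_conj_reduced {F : Type*} [Group F] [Finite F] (φ : F →* VT n) :
    ∃ (x : VT n) (a : OrdPair n → ℤ), (∀ p, 0 < a p) ∧
      ∀ f, ∃ (l : List (OrdPair n)) (σ : Perm (Fin n)),
        x * φ f * x⁻¹ = (l.map kappa).prod * vtLambda n σ ∧ permWeights n σ a = a ∧
        ∀ p ∈ l, a p = 2 * nbrSum (pairGraph n) a p := by
  obtain ⟨x, a, hpos, hdom, hfix⟩ := exists_fixed_weights φ
  refine ⟨x, a, hpos, fun f => ?_⟩
  obtain ⟨l, σ, hl, h⟩ := exists_reduced_eq (x * φ f * x⁻¹)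
  have h1 := hfix f
  rw [h, vtWeights_prod_kappa_mul] at h1
  have h2 := (hl.le_wordReflection (hdom.permWeights σ)).1
  rw [h1] at h2
  -- A permutation of the weights that nowhere exceeds them has the same sum.
  have h3 : permWeights n σ a = a := by
    have hsum : ∑ p, permWeights n σ a p = ∑ p, a p :=
      Fintype.sum_equiv (MulAction.toPerm σ⁻¹) _ _ fun p => rfl
    exact funext fun p =>
      (Finset.sum_eq_sum_iff_of_le fun p _ => h2 p).1 hsum p (Finset.mem_univ p)
  rw [h3] at h1
  exact ⟨l, σ, h, h3, hl.eq_two_mul_nbrSum hdom h1⟩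

/-- A section of `θ` is conjugate to `λ`: the weights fixed by its image are invariant under
`S_n`, hence constant, and no reflection fixes positive constant weights. -/
theorem conjugateHoms_vtLambda {φ : Perm (Fin n) →* VT n}
    (hφ : (vtTheta n).comp φ = MonoidHom.id _) : ConjugateHoms φ (vtLambda n) := by
  obtain ⟨x, a, hpos, h⟩ := exists_conj_reduced φ
  have hθ : ∀ f, vtTheta n (φ f) = f := DFunLike.congr_fun hφ
  have hinv : ∀ σ, permWeights n σ a = a := by
    intro σ
    obtain ⟨l, τ, h1, h2, -⟩ := h ((vtTheta n x)⁻¹ * σ * vtTheta n x)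
    have h3 := congrArg (vtTheta n) h1
    rw [vtTheta_prod_kappa_mul, map_mul, map_mul, hθ, map_inv] at h3
    rwa [show σ = τ by rw [← h3]; group]
  have hconst : ∀ p q, a p = a q := by
    intro p q
    obtain ⟨σ, rfl⟩ := exists_smul_eq_ordPair p q
    have := congrFun (hinv σ) (σ • p)
    rwa [permWeights_apply, inv_smul_smul] at this
  have hne : ∀ p, a p ≠ 2 * nbrSum (pairGraph n) a p := by
    intro p hp
    obtain ⟨q, hq⟩ := exists_pairGraph_adj p
    have h1 := le_nbrSum (fun r => (hpos r).le) hq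
    have h2 := hconst p q
    have h3 := hpos p
    linarith
  refine ⟨(vtLambda n (vtTheta n x))⁻¹ * x, MonoidHom.ext fun f => ?_⟩
  obtain ⟨l, τ, h1, -, h2⟩ := h f
  have hl : l = [] := List.eq_nil_iff_forall_not_mem.2 fun p hp => hne p (h2 p hp)
  have h3 := congrArg (vtTheta n) h1
  rw [vtTheta_prod_kappa_mul, map_mul, map_mul, hθ, map_inv] at h3
  rw [hl, ← h3, List.map_nil, List.prod_nil, one_mul, map_mul, map_mul, map_inv] at h1
  simp only [MonoidHom.comp_apply, MulEquiv.coe_toMonoidHom, MulAut.conj_apply]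
  calc vtLambda n f = (vtLambda n (vtTheta n x))⁻¹ * (vtLambda n (vtTheta n x) * vtLambda n f *
          (vtLambda n (vtTheta n x))⁻¹) * vtLambda n (vtTheta n x) := by group
    _ = _ := by rw [← h1]; group

/-- Finite subgroups of the kernel of `θ` are commutative. -/
theorem commute_of_vtTheta_comp_eq_one {F : Type*} [Group F] [Finite F] {φ : F →* VT n}
    (hφ : (vtTheta n).comp φ = 1) (f g : F) : Commute (φ f) (φ g) := by
  obtain ⟨x, a, hpos, h⟩ := exists_conj_reduced φ
  have hmem : ∀ f, ∃ l : List (OrdPair n), x * φ f * x⁻¹ = (l.map kappa).prod ∧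
      ∀ p ∈ l, a p = 2 * nbrSum (pairGraph n) a p := by
    intro f
    obtain ⟨l, τ, h1, -, h2⟩ := h f
    have h3 := congrArg (vtTheta n) h1
    have h4 : vtTheta n (φ f) = 1 := DFunLike.congr_fun hφ f
    rw [vtTheta_prod_kappa_mul, map_mul, map_mul, h4, mul_one, ← map_mul, mul_inv_cancel,
      map_one] at h3
    exact ⟨l, by rw [h1, ← h3, map_one, mul_one], h2⟩
  obtain ⟨l, hl, hl'⟩ := hmem f
  obtain ⟨m, hm, hm'⟩ := hmem g
  have : Commute (x * φ f * x⁻¹) (x * φ g * x⁻¹) := by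
    rw [hl, hm]
    refine Commute.list_prod_left _ _ fun y hy => Commute.list_prod_right _ _ fun z hz => ?_
    obtain ⟨p, hp, rfl⟩ := List.mem_map.1 hy
    obtain ⟨q, hq, rfl⟩ := List.mem_map.1 hz
    exact kappa_comm p q (not_adj_of_eq_two_mul_nbrSum hpos (hl' p hp) (hm' q hq))
  exact (Commute.conj_iff x).1 this

end FixedPoint

/-! ### Automorphisms of symmetric groups -/

section Automorphisms

variable {α : Type*} [DecidableEq α]

theorem swap_eq_of_isSwap {s : Perm α} (hs : s.IsSwap) {a : α} (ha : s a ≠ a) :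
    s = swap a (s a) := by
  obtain ⟨x, y, hxy, rfl⟩ := hs
  rcases (swap_apply_ne_self_iff.1 ha).2 with rfl | rfl
  · simp
  · rw [swap_apply_right, swap_comm]

/-- Non-commuting transpositions have a point in common, and only one. -/
theorem exists_eq_swap_of_not_commute {s t : Perm α} (hs : s.IsSwap) (ht : t.IsSwap)
    (h : ¬ Commute s t) : ∃ a b c, a ≠ b ∧ a ≠ c ∧ b ≠ c ∧ s = swap a b ∧ t = swap a c := by
  obtain ⟨a, ha, ha'⟩ : ∃ a, s a ≠ a ∧ t a ≠ a := by
    by_contra! hd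
    refine h (Perm.Disjoint.commute fun a => ?_)
    by_contra! h'
    exact h'.2 (hd a h'.1)
  refine ⟨a, s a, t a, ha.symm, ha'.symm, fun h' => h ?_, swap_eq_of_isSwap hs ha,
    swap_eq_of_isSwap ht ha'⟩
  have hst : s = t := by rw [swap_eq_of_isSwap hs ha, h', ← swap_eq_of_isSwap ht ha']
  exact hst ▸ Commute.refl s

theorem not_commute_swap_swap {a b c : α} (hab : a ≠ b) (hac : a ≠ c) (hbc : b ≠ c) :
    ¬ Commute (swap a b) (swap a c) := by
  intro h
  have := DFunLike.congr_fun h.eq a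
  simp only [Perm.mul_apply, swap_apply_left] at this
  rw [swap_apply_of_ne_of_ne hac.symm hbc.symm, swap_apply_of_ne_of_ne hab.symm hbc] at this
  exact hbc this.symm

variable [Fintype α]

/-- An automorphism that preserves transpositions is inner. The images of the transpositions
`(o i)`, for fixed `o`, pairwise do not commute and no three of them are the transpositions of a
triangle, so they all move a common point `a`; the automorphism is the conjugation by the
permutation that sends `o` to `a` and `i` to the other point moved by the image of `(o i)`. -/
theorem isInner_of_isSwap (hα : 2 < Fintype.card α) {β : MulAut (Perm α)}
    (hβ : ∀ s : Perm α, s.IsSwap → (β s).IsSwap) : IsInner β := by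
  obtain ⟨o, x, y, hox, hoy, hxy⟩ := Fintype.two_lt_card_iff.1 hα
  have hsw : ∀ i, o ≠ i → (β (swap o i)).IsSwap := fun i hi => hβ _ ⟨o, i, hi, rfl⟩
  have hnc : ∀ i j, o ≠ i → o ≠ j → i ≠ j → ¬ Commute (β (swap o i)) (β (swap o j)) := by
    intro i j hi hj hij h
    refine not_commute_swap_swap hi hj hij (β.injective ?_)
    rw [map_mul, map_mul, h.eq]
  obtain ⟨a, b, c, hab, hac, hbc, hx, hy⟩ :=
    exists_eq_swap_of_not_commute (hsw x hox) (hsw y hoy) (hnc x y hox hoy hxy)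
  have hmove : ∀ i, o ≠ i → β (swap o i) a ≠ a := by
    intro i hi ha
    have hix : i ≠ x := by rintro rfl; rw [hx, swap_apply_left] at ha; exact hab ha.symm
    have hiy : i ≠ y := by rintro rfl; rw [hy, swap_apply_left] at ha; exact hac ha.symm
    have hfix : ∀ d, a ≠ d → ¬ Commute (swap a d) (β (swap o i)) → β (swap o i) d ≠ d := by
      intro d _ hd hd'
      refine hd (Perm.Disjoint.commute fun z => ?_)
      rcases eq_or_ne z a with rfl | hza
      · exact Or.inr ha
      rcases eq_or_ne z d with rfl | hzd
      · exact Or.inr hd'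
      · exact Or.inl (swap_apply_of_ne_of_ne hza hzd)
    have hb := hfix b hab (hx ▸ hnc x i hox hi hix.symm)
    have hc := hfix c hac (hy ▸ hnc y i hoy hi hiy.symm)
    -- Otherwise the images of `(o x)`, `(o y)`, `(o i)` form a triangle, but its third side is the
    -- image of `(x y)`.
    have hbc' : β (swap o i) = swap b c := by
      obtain ⟨u, v, -, huv⟩ := hsw i hi
      rw [huv] at hb hc ⊢
      rcases (swap_apply_ne_self_iff.1 hb).2 with rfl | rfl <;>
        rcases (swap_apply_ne_self_iff.1 hc).2 with rfl | rfl
      · exact absurd rfl hbc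
      · rfl
      · exact swap_comm _ _
      · exact absurd rfl hbc
    have h1 : β (swap x y) = swap b c := by
      have h2 := swap_apply_apply (swap o x) o y
      rw [swap_apply_left, swap_apply_of_ne_of_ne hoy.symm hxy.symm] at h2
      have h3 := swap_apply_apply (swap a b) a c
      rw [swap_apply_left, swap_apply_of_ne_of_ne hac.symm hbc.symm] at h3
      rw [h2, map_mul, map_mul, map_inv, hx, hy, h3]
    have h2 := DFunLike.congr_fun (β.injective (hbc'.trans h1.symm)) o
    rw [swap_apply_left, swap_apply_of_ne_of_ne hox hoy] at h2
    exact hi h2.symm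
  have hoo : β (swap o o) = 1 := by rw [swap_self]; exact map_one β
  -- This includes `i = o`, where both sides are `1`; so the formula below for `f` needs no cases.
  have hstar : ∀ i, β (swap o i) = swap a (β (swap o i) a) := by
    intro i
    rcases eq_or_ne o i with rfl | hi
    · rw [hoo, Perm.one_apply, swap_self]
      rfl
    · exact swap_eq_of_isSwap (hsw i hi) (hmove i hi)
  have hinj : Function.Injective fun i => β (swap o i) a := by
    intro i j hij
    simp only at hij
    have h1 : swap o i = swap o j := β.injective (by rw [hstar i, hij, ← hstar j])
    simpa using DFunLike.congr_fun h1 o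
  set f : Perm α := Equiv.ofBijective _ (Finite.injective_iff_bijective.1 hinj) with hf
  have hf' : ∀ i, f i = β (swap o i) a := fun _ => rfl
  have hfo : f o = a := by rw [hf', hoo, Perm.one_apply]
  have key : ∀ i, β (swap o i) = f * swap o i * f⁻¹ := by
    intro i
    rw [← swap_apply_apply, hfo, hf', ← hstar]
  refine ⟨f, ?_⟩
  have h : β.toMonoidHom = (MulAut.conj f).toMonoidHom := by
    refine MonoidHom.eq_of_eqOn_denseM (Perm.mclosure_isSwap) ?_
    rintro _ ⟨i, j, hij, rfl⟩
    simp only [MulEquiv.coe_toMonoidHom, MulAut.conj_apply]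
    rcases eq_or_ne o j with rfl | hj
    · rw [swap_comm, key]
    have h2 := swap_apply_apply (swap o i) o j
    rw [swap_apply_left, swap_apply_of_ne_of_ne hj.symm hij.symm] at h2
    rw [h2, map_mul, map_mul, map_inv, key, key]
    group
  exact MulEquiv.ext fun g => DFunLike.congr_fun (F := Perm α →* Perm α) h g

open Nat in
/-- The only coincidence between the sizes of the class of transpositions and of another class of
involutions of `S_n`. -/
theorem eq_one_or_of_card_centralizer {n k : ℕ} (hk : 1 ≤ k) (hn : 2 * k ≤ n)
    (h : (n - 2 * k)! * 2 ^ k * k ! = (n - 2)! * 2) : k = 1 ∨ n = 6 ∧ k = 3 := by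
  obtain ⟨m, rfl⟩ := Nat.exists_eq_add_of_le hn
  rw [Nat.add_sub_cancel_left] at h
  have hm := Nat.factorial_pos m
  obtain rfl | rfl | rfl | hk4 : k = 1 ∨ k = 2 ∨ k = 3 ∨ 4 ≤ k := by omega
  · exact Or.inl rfl
  · rw [show 2 * 2 + m - 2 = m + 2 by omega, Nat.factorial_succ (m + 1), Nat.factorial_succ m,
      show 2 ! = 2 by rfl] at h
    have h1 : 4 = (m + 2) * (m + 1) := Nat.eq_of_mul_eq_mul_left hm (by linarith)
    have h2 : m < 2 := by nlinarith
    interval_cases m <;> omega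
  · refine Or.inr ⟨?_, rfl⟩
    rw [show 2 * 3 + m - 2 = m + 4 by omega, Nat.factorial_succ (m + 3),
      Nat.factorial_succ (m + 2), Nat.factorial_succ (m + 1), Nat.factorial_succ m,
      show 3 ! = 6 by rfl] at h
    have h1 : 24 = (m + 4) * ((m + 3) * ((m + 2) * (m + 1))) :=
      Nat.eq_of_mul_eq_mul_left hm (by linarith)
    rcases Nat.eq_zero_or_pos m with rfl | hm'
    · rfl
    · have : (1 + 4) * ((1 + 3) * ((1 + 2) * (1 + 1))) ≤
        (m + 4) * ((m + 3) * ((m + 2) * (m + 1))) := by gcongr <;> omega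
      omega
  · exfalso
    have h1 : m ! * (2 * k - 2)! ≤ (2 * k + m - 2)! := by
      rw [show 2 * k + m - 2 = m + (2 * k - 2) by omega]
      exact Nat.le_of_dvd (Nat.factorial_pos _) (Nat.factorial_mul_factorial_dvd_factorial_add _ _)
    have h2 : 2 ^ k * k ! < (2 * k - 2)! * 2 := by
      clear h h1 hn
      induction k, hk4 using Nat.le_induction with
      | base => decide
      | succ k hk4 ih =>
        have := ih (by omega)
        rw [show 2 * (k + 1) - 2 = (2 * k - 2) + 1 + 1 by omega,
          Nat.factorial_succ (2 * k - 2 + 1), Nat.factorial_succ (2 * k - 2),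
          Nat.factorial_succ k, pow_succ]
        calc 2 ^ k * 2 * ((k + 1) * k !) = 2 * (k + 1) * (2 ^ k * k !) := by ring
          _ < 2 * (k + 1) * ((2 * k - 2)! * 2) := by gcongr
          _ ≤ ((2 * k - 2 + 1 + 1) * (2 * k - 2 + 1)) * ((2 * k - 2)! * 2) := by
            refine Nat.mul_le_mul_right _ ?_
            rw [mul_comm 2]
            exact Nat.mul_le_mul (by omega) (by omega)
          _ = _ := by ring
    have h3 : m ! * (2 ^ k * k !) < m ! * ((2 * k - 2)! * 2) := by gcongr
    rw [mul_assoc] at h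
    nlinarith

/-- An automorphism sends a transposition to a transposition or, in `S_6`, to a product of three
disjoint ones, because it preserves orders of centralizers. -/
theorem cycleType_map_isSwap {n : ℕ} (β : MulAut (Perm (Fin n))) {s : Perm (Fin n)}
    (hs : s.IsSwap) : (β s).IsSwap ∨ n = 6 ∧ (β s).cycleType = Multiset.replicate 3 2 := by
  have hord : orderOf (β s) = 2 := by
    rw [MulEquiv.orderOf_eq, ← Perm.lcm_cycleType, Perm.isSwap_iff_cycleType.1 hs]
    rfl
  obtain ⟨k, hk⟩ := Perm.cycleType_prime_order (hord ▸ Nat.prime_two)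
  rw [hord] at hk
  have hcard : Nat.card (Subgroup.centralizer {β s}) = Nat.card (Subgroup.centralizer {s}) := by
    refine Nat.card_congr (β.toEquiv.subtypeEquiv fun g => ?_).symm
    simp only [Subgroup.mem_centralizer_singleton_iff]
    exact (β.injective.eq_iff.symm.trans (by simp [map_mul]))
  rw [Perm.nat_card_centralizer, Perm.nat_card_centralizer, Perm.isSwap_iff_cycleType.1 hs,
    hk] at hcard
  have hle := Perm.sum_cycleType_le (β s)
  rw [hk] at hle
  rw [Multiset.toFinset_replicate, if_neg k.succ_ne_zero, Multiset.toFinset_singleton,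
    Finset.prod_singleton, Finset.prod_singleton, Multiset.count_replicate_self,
    Multiset.count_singleton_self, Multiset.sum_replicate, Multiset.sum_singleton,
    Multiset.prod_replicate, Multiset.prod_singleton, Fintype.card_fin, Nat.factorial_one,
    mul_one, smul_eq_mul] at hcard
  rw [Multiset.sum_replicate, smul_eq_mul, Fintype.card_fin] at hle
  rw [Perm.isSwap_iff_cycleType, hk]
  rcases eq_one_or_of_card_centralizer (n := n) (k := k + 1) (by omega) (by omega)
    (by rw [mul_comm 2]; exact hcard) with h | ⟨h, h'⟩
  · exact Or.inl (by rw [h]; rfl)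
  · exact Or.inr ⟨h, by rw [h']⟩

theorem isInner_of_ne_six {n : ℕ} (hn : 3 ≤ n) (hn6 : n ≠ 6) (β : MulAut (Perm (Fin n))) :
    IsInner β :=
  isInner_of_isSwap (by simpa using Nat.lt_of_succ_le hn) fun _ hs =>
    (cycleType_map_isSwap β hs).resolve_right fun h => hn6 h.1

theorem IsInner.inv {G : Type*} [Group G] {β : MulAut G} (h : IsInner β) : IsInner β⁻¹ := by
  obtain ⟨x, rfl⟩ := h
  exact ⟨x⁻¹, (map_inv _ _).symm⟩

theorem cycleType_map_of_not_isInner {β : MulAut (Perm (Fin 6))} (hβ : ¬ IsInner β)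
    {s : Perm (Fin 6)} (hs : s.IsSwap) : (β s).cycleType = Multiset.replicate 3 2 := by
  have h : ∃ t : Perm (Fin 6), t.IsSwap ∧ ¬ (β t).IsSwap := by
    by_contra! h
    exact hβ (isInner_of_isSwap (by simp) h)
  obtain ⟨t, ht, ht'⟩ := h
  have hst : IsConj s t := by
    rw [Perm.isConj_iff_cycleType_eq, Perm.isSwap_iff_cycleType.1 hs,
      Perm.isSwap_iff_cycleType.1 ht]
  have h1 : IsConj (β s) (β t) := MonoidHom.map_isConj β.toMonoidHom hst
  rw [Perm.isConj_iff_cycleType_eq.1 h1]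
  exact ((cycleType_map_isSwap β ht).resolve_left ht').2

/-- Two non-inner automorphisms of `S_6` differ by an inner one: both exchange the transpositions
and the products of three disjoint transpositions. -/
theorem isInner_mul_inv_of_not_isInner {β ν : MulAut (Perm (Fin 6))} (hβ : ¬ IsInner β)
    (hν : ¬ IsInner ν) : IsInner (β * ν⁻¹) := by
  have inv_not : ∀ {γ : MulAut (Perm (Fin 6))}, ¬ IsInner γ → ¬ IsInner γ⁻¹ := fun h h' =>
    h (by simpa using h'.inv)
  refine isInner_of_isSwap (by simp) fun s hs => ?_
  have h1 := cycleType_map_of_not_isInner (inv_not hν) hs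
  have h2 := cycleType_map_of_not_isInner (inv_not hβ) hs
  have h3 : IsConj (ν⁻¹ s) (β⁻¹ s) := Perm.isConj_iff_cycleType_eq.2 (h1.trans h2.symm)
  have h4 : IsConj (β (ν⁻¹ s)) (β (β⁻¹ s)) := MonoidHom.map_isConj β.toMonoidHom h3
  rw [MulAut.apply_inv_self, Perm.isConj_iff_cycleType_eq] at h4
  rw [Perm.isSwap_iff_cycleType, MulAut.mul_apply, h4, Perm.isSwap_iff_cycleType.1 hs]

end Automorphisms

/-! ### Homomorphisms from symmetric groups -/

/-- An inner automorphism in front of `λ` can be absorbed into the conjugation of the target. -/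
theorem ConjugateHoms.of_comp_conj_comp {F G H : Type*} [Group F] [Group G] [Group H]
    {φ : F →* H} {f : G →* H} {x : G} {g : F →* G}
    (h : ConjugateHoms φ (f.comp ((MulAut.conj x).toMonoidHom.comp g))) :
    ConjugateHoms φ (f.comp g) := by
  obtain ⟨y, hy⟩ := h
  refine ⟨(f x)⁻¹ * y, MonoidHom.ext fun z => ?_⟩
  have := DFunLike.congr_fun hy z
  simp only [MonoidHom.comp_apply, MulEquiv.coe_toMonoidHom, MulAut.conj_apply, map_mul,
    map_inv] at this
  change f (g z) = (f x)⁻¹ * y * φ z * ((f x)⁻¹ * y)⁻¹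
  calc f (g z) = (f x)⁻¹ * (f x * f (g z) * (f x)⁻¹) * f x := by group
    _ = _ := by rw [this]; group

theorem isAbelianHom_of_alternatingGroup_le_ker {n : ℕ} {G : Type*} [Group G]
    {φ : Perm (Fin n) →* G} (h : alternatingGroup (Fin n) ≤ φ.ker) : φ.IsAbelianHom := by
  rintro _ ⟨f, rfl⟩ _ ⟨g, rfl⟩
  have h1 : f * g * f⁻¹ * g⁻¹ ∈ φ.ker :=
    h (alternatingGroup.commutator_perm_le
      (Subgroup.commutator_mem_commutator (Subgroup.mem_top f) (Subgroup.mem_top g)))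
  rwa [MonoidHom.mem_ker, map_mul, map_mul, map_mul, map_inv, map_inv, mul_inv_eq_one,
    mul_inv_eq_iff_eq_mul] at h1

/-- If `θ ∘ φ` kills the alternating group, then so does `φ`: the alternating group is perfect
and its image is a finite subgroup of the kernel of `θ`. -/
theorem alternatingGroup_le_ker {n m : ℕ} (hn : 5 ≤ n) {φ : Perm (Fin n) →* VT m}
    (h : alternatingGroup (Fin n) ≤ ((vtTheta m).comp φ).ker) :
    alternatingGroup (Fin n) ≤ φ.ker := by
  have h1 : (vtTheta m).comp (φ.comp (alternatingGroup (Fin n)).subtype) = 1 :=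
    MonoidHom.ext fun f => h f.2
  rw [← commutator_alternatingGroup_eq_self (by simpa using hn), Subgroup.commutator_le]
  intro f hf g hg
  rw [MonoidHom.mem_ker, map_commutatorElement, commutatorElement_eq_one_iff_mul_comm]
  exact commute_of_vtTheta_comp_eq_one h1 ⟨f, hf⟩ ⟨g, hg⟩

/-- If `θ ∘ φ` is an automorphism, then `φ` is conjugate to its composition with `λ`. -/
theorem conjugateHoms_of_vtTheta_comp_eq {n : ℕ} {φ : Perm (Fin n) →* VT n}
    {β : MulAut (Perm (Fin n))} (h : (vtTheta n).comp φ = β.toMonoidHom) :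
    ConjugateHoms φ ((vtLambda n).comp β.toMonoidHom) := by
  have h1 : (vtTheta n).comp (φ.comp β⁻¹.toMonoidHom) = MonoidHom.id _ := by
    rw [← MonoidHom.comp_assoc, h]
    exact MonoidHom.ext fun f => MulAut.apply_inv_self _ β f
  obtain ⟨x, hx⟩ := conjugateHoms_vtLambda h1
  refine ⟨x, ?_⟩
  rw [hx]
  exact MonoidHom.ext fun f => by simp

theorem theorem5p20 :
    (∀ n m : ℕ, m ≤ n → 5 ≤ n → 2 ≤ m →
      ∀ ν : MulAut (Equiv.Perm (Fin 6)), ¬ IsInner ν →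
      ∀ φ : Equiv.Perm (Fin n) →* VT m,
        φ.IsAbelianHom ∨
        (∃ h : n = m, ConjugateHoms φ ((vtLambda m).comp (permCast h))) ∨
        (∃ (hn : n = 6) (hm : 6 = m),
          ConjugateHoms φ
            ((vtLambda m).comp ((permCast hm).comp (ν.toMonoidHom.comp (permCast hn)))))) ∧
    (∀ n : ℕ, 3 ≤ n → ∀ φ : Equiv.Perm (Fin n) →* VT n,
      (vtTheta n).comp φ = MonoidHom.id (Equiv.Perm (Fin n)) →
        ConjugateHoms φ (vtLambda n)) := by
  refine ⟨fun n m hmn hn _ ν hν φ => ?_, fun n _ φ hφ => conjugateHoms_vtLambda hφ⟩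
  rcases Subgroup.bot_or_nontrivial ((vtTheta m).comp φ).ker with hker | hker
  · right
    have hinj := (MonoidHom.ker_eq_bot_iff _).1 hker
    obtain rfl : n = m := by
      refine le_antisymm ?_ hmn
      by_contra! hlt
      have h1 := Fintype.card_le_of_injective _ hinj
      rw [Fintype.card_perm, Fintype.card_perm, Fintype.card_fin, Fintype.card_fin] at h1
      exact absurd h1 (not_le.2 ((Nat.factorial_lt_of_lt (by omega) hlt)))
    let β : MulAut (Perm (Fin n)) :=
      MulEquiv.ofBijective _ (Finite.injective_iff_bijective.1 hinj)
    have h2 : ConjugateHoms φ ((vtLambda n).comp β.toMonoidHom) :=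
      conjugateHoms_of_vtTheta_comp_eq rfl
    by_cases hβ : IsInner β
    · obtain ⟨x, hx⟩ := hβ
      rw [hx] at h2
      exact Or.inl ⟨rfl, h2.of_comp_conj_comp (g := MonoidHom.id _)⟩
    · obtain rfl : n = 6 := by
        by_contra h6
        exact hβ (isInner_of_ne_six (by omega) h6 β)
      obtain ⟨x, hx⟩ := isInner_mul_inv_of_not_isInner hβ hν
      rw [mul_inv_eq_iff_eq_mul] at hx
      rw [hx] at h2
      exact Or.inr ⟨rfl, rfl, h2.of_comp_conj_comp (g := ν.toMonoidHom)⟩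
  · exact Or.inl (isAbelianHom_of_alternatingGroup_le_ker (alternatingGroup_le_ker hn
      (Perm.alternatingGroup_le_of_normal (by simpa using hn) hker)))
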